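/- Let $G$ be a discrete group (possibly finite) with identity $e$, let $\lambda$ be its left regular representation on $\ell^2(G)$, let $VN(G)$ be the von Neumann algebra generated by $\lambda(G)$, and let $\tau_0(T)=\langle T\delta_e,\delta_e\rangle$ be its usual trace, with $\|T\|_{L^p(\tau_0)}=\tau_0(|T|^p)^{1/p}$. For $f\in\ell^2(G)$ let $\|f\|_{VN(G)}$ be the operator norm of the (unique) $T\in VN(G)$ with $T\delta_e=f$, and $\infty$ if there is no such $T$. Let $E\subseteq G$. For $2<q<\infty$, $E$ is a $\Lambda(q)$ set if there is $C>0$ with $\bigl\|\sum_{t}f(t)\lambda(t)\bigr\|_{L^q(\tau_0)}\le C\bigl(\sum_t|f(t)|^2\bigr)^{1/2}$ for all finitely supported functions $f$ with support in $E$; the infimum of all such $C$ is the $\Lambda(q)$ constant of $E$. $E$ is a Leinert set if there is $C>0$ with $\|f\|_{VN(G)}\le C\|f\|_2$ for all $f\in\ell^2(G)$ supported in $E$; the infimum of all such $C$ is the Leinert constant of $E$. A set $F\subseteq G$ of pairwise commuting elements is quasi-independent if the products $\prod_{x\in S}x$, over the finite subsets $S\subseteq F$, are all distinct. (i) Suppose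 $2<q<\infty$ and $E$ is a $\Lambda(q)$ set with $\Lambda(q)$ constant $A$. If $a\in G$ has (finite or infinite) order at least $2n$, where $n$ is a natural number, then $$\bigl|E\cap\{a,a^2,\dots,a^n\}\bigr|\le 10A^2n^{2/q}.$$ (ii) Suppose $E$ is a Leinert set with Leinert constant $B$, and let $F\subseteq E$ be a finite, commuting, quasi-independent subset. Then $|F|\le 6^3B^2$. -/

import Mathlib

open scoped ENNReal

noncomputable section

namespace DiscreteGroup

/-- The Hilbert space `ℓ²(G)` of square-summable complex functions on the discrete group `G`. -/
abbrev L2 (G : Type*) := lp (fun _ : G => ℂ) 2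

/-- `|T|^p`, where `|T| = (T* T)^{1/2}`, for a bounded operator `T` on a Hilbert space, through the
continuous functional calculus. -/
def absPow {H : Type*} [NormedAddCommGroup H] [InnerProductSpace ℂ H] [CompleteSpace H]
    (T : H →L[ℂ] H) (p : ℝ) : H →L[ℂ] H :=
  CFC.abs T ^ p

variable {G : Type*} [Group G]

/-- The point mass at the identity of `G`, as a vector of `ℓ²(G)`. -/
def deltaOne (G : Type*) [Group G] : L2 G :=
  open Classical in lp.single 2 (1 : G) (1 : ℂ)

/-- Translation by `t`, `(λ(t) g)(s) = g(t⁻¹ s)`, as a linear isometry of `ℓ²(G)`. -/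
def translate (t : G) : L2 G →ₗᵢ[ℂ] L2 G where
  toFun g := ⟨fun s => g (t⁻¹ * s), by
    have h := (memℓp_gen_iff (p := 2) (by norm_num)).1 (lp.memℓp g)
    exact (memℓp_gen_iff (p := 2) (by norm_num)).2
      ((Equiv.mulLeft t⁻¹).summable_iff.2 h)⟩
  map_add' _ _ := rfl
  map_smul' _ _ := rfl
  norm_map' g := by
    rw [lp.norm_eq_tsum_rpow (by norm_num), lp.norm_eq_tsum_rpow (by norm_num)]
    congr 1
    exact (Equiv.mulLeft t⁻¹).tsum_eq (fun s => ‖g s‖ ^ (2 : ℝ≥0∞).toReal)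

/-- The left regular representation `λ` of `G` on `ℓ²(G)`. -/
def leftRegular (G : Type*) [Group G] : G →* (L2 G →L[ℂ] L2 G) where
  toFun t := (translate t).toContinuousLinearMap
  map_one' := by
    ext g s
    change g (1⁻¹ * s) = g s
    simp
  map_mul' t u := by
    ext g s
    change g ((t * u)⁻¹ * s) = g (u⁻¹ * (t⁻¹ * s))
    simp [mul_assoc]

/-- The group von Neumann algebra `VN(G)`: the von Neumann algebra generated by `λ(G)`, i.e. the
double commutant of the self-adjoint set `λ(G) ∪ λ(G)*`. -/
def groupVN (G : Type*) [Group G] : VonNeumannAlgebra (L2 G) where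
  toStarSubalgebra :=
    StarSubalgebra.centralizer ℂ
      (StarSubalgebra.centralizer ℂ (Set.range (leftRegular G)) : Set (L2 G →L[ℂ] L2 G))
  centralizer_centralizer' := Set.centralizer_centralizer_centralizer _

/-- The convolution operator `λ(f) = ∑ f(t) λ(t)` of a finitely supported function `f`. -/
def convOp (f : G →₀ ℂ) : L2 G →L[ℂ] L2 G :=
  f.sum fun t c => c • leftRegular G t

/-- The usual trace `τ₀(T) = ⟨T δ_e, δ_e⟩` (used on the elements of `VN(G)`). -/
def trace (T : L2 G →L[ℂ] L2 G) : ℂ :=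
  inner ℂ (deltaOne G) (T (deltaOne G))

/-- The norm `‖T‖_{L^p(τ₀)} = τ₀(|T|^p)^{1/p}` of the noncommutative `L^p`-space of
`(VN(G), τ₀)` (used on the elements of `VN(G)`). -/
def ncLpNorm (p : ℝ) (T : L2 G →L[ℂ] L2 G) : ℝ :=
  (trace (absPow T p)).re ^ (1 / p)

/-- The set of `C > 0` such that `‖∑ f(t) λ(t)‖_{L^p(τ₀)} ≤ C (∑ |f(t)|²)^{1/2}` for every
finitely supported function `f` on `E`. -/
def lambdaBounds (p : ℝ) (E : Set G) : Set ℝ :=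
  {C | 0 < C ∧ ∀ f : G →₀ ℂ, (f.support : Set G) ⊆ E →
    ncLpNorm p (convOp f) ≤ C * Real.sqrt (∑ t ∈ f.support, ‖f t‖ ^ 2)}

/-- `E` is a `Λ(p)` set (for `2 < p < ∞`). -/
def IsLambdaSet (p : ℝ) (E : Set G) : Prop := (lambdaBounds p E).Nonempty

/-- The `Λ(p)` constant of `E`. -/
def lambdaConst (p : ℝ) (E : Set G) : ℝ := sInf (lambdaBounds p E)

/-- The `VN(G)`-norm of `f ∈ ℓ²(G)`: the operator norm of the element `T` of `VN(G)` with
`T δ_e = f` (that is, of convolution by `f`), and `∞` if there is none. There is at most one such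
`T`, as `δ_e` is separating for `VN(G)`. -/
def vnNorm (f : L2 G) : ℝ≥0∞ :=
  ⨅ (T : L2 G →L[ℂ] L2 G) (_ : T ∈ groupVN G) (_ : T (deltaOne G) = f), ‖T‖ₑ

/-- The set of `C > 0` such that `‖f‖_{VN(G)} ≤ C ‖f‖₂` for every `f ∈ ℓ²(E)`. -/
def leinertBounds (E : Set G) : Set ℝ :=
  {C | 0 < C ∧ ∀ f : L2 G, (∀ x, x ∉ E → f x = 0) → vnNorm f ≤ ENNReal.ofReal C * ‖f‖ₑ}

/-- `E` is a Leinert (or `Λ(∞)`) set. -/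
def IsLeinert (E : Set G) : Prop := (leinertBounds E).Nonempty

/-- The Leinert constant of `E`. -/
def leinertConst (E : Set G) : ℝ := sInf (leinertBounds E)

/-- A set `F` of pairwise commuting elements is quasi-independent if the products
`∏_{x ∈ S} x` over its finite subsets `S` are all distinct. -/
def QuasiIndependent (F : Set G) (hF : F.Pairwise Commute) : Prop :=
  ∀ (S T : Finset G) (hS : (S : Set G) ⊆ F) (hT : (T : Set G) ⊆ F),
    S.noncommProd id (hF.mono hS) = T.noncommProd id (hF.mono hT) → S = T

end DiscreteGroup

end

open scoped ENNReal

noncomputable section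

namespace DiscreteGroup

/-! ### Bounding an operator by its absolute power. -/

section OperatorInequality

variable {H : Type*} [NormedAddCommGroup H] [InnerProductSpace ℂ H] [CompleteSpace H]

/-! Both bounds come from testing `T`, convolution by the indicator of `F`, on finite indicators:
the number of pairs in `F × Y` with product in `Z` is `⟨1_Z, T 1_Y⟩`, hence at most `|Z|^{1/2} ‖T
1_Y‖` (`card_mul_mem_le_norm`).

(i) With `Y = {a,…,a^n}` and `Z = {a,…,a^{2n}}` every pair counts. Functional calculus gives `|T|² ≤
s² + s^{2-q}|T|^q`; all diagonal entries of `|T|^q` equal its trace, so its form at `1_Y` is at most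
`n² τ₀(|T|^q)`. Taking `s` down to `n^{1/q}‖T‖_q` gives `|F|² ≤ 4 n^{2/q}‖T‖_q² ≤ 4 n^{2/q} C²|F|`.

(ii) With `Y = Z` the set of subset products, half of all pairs count, so `|F|/2 ≤ ‖T‖`, while the
Leinert bound is `C|F|^{1/2}`.

Both arguments give the constant 4, better than stated. -/

/-- For `0 < s` and `2 ≤ q`, the elementary bound `x² ≤ s² + s^(2-q) x^q` on `[0, ∞)`. -/
theorem mul_self_le_sq_add_rpow {s q x : ℝ} (hs : 0 < s) (hq : 2 ≤ q) (hx : 0 ≤ x) :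
    x * x ≤ s ^ 2 + s ^ (2 - q) * x ^ q := by
  rcases le_total x s with h | h
  · have : 0 ≤ s ^ (2 - q) * x ^ q := by positivity
    nlinarith
  · have hx' : 0 < x := hs.trans_le h
    have h1 : x ^ (2 - q) ≤ s ^ (2 - q) :=
      Real.rpow_le_rpow_of_nonpos hs h (by linarith)
    have h2 : x ^ (2 - q) * x ^ q = x * x := by
      rw [← Real.rpow_add hx', sub_add_cancel, Real.rpow_two, sq]
    have h3 : x ^ (2 - q) * x ^ q ≤ s ^ (2 - q) * x ^ q := by gcongr
    nlinarith [sq_nonneg s]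

theorem absPow_nonneg (T : H →L[ℂ] H) (q : ℝ) : 0 ≤ absPow T q := CFC.rpow_nonneg

theorem commute_absPow {T R : H →L[ℂ] H} (h : Commute (star T * T) R) (q : ℝ) :
    Commute (absPow T q) R :=
  Commute.cfc_nnreal (h.cfcₙ_nnreal _) _

theorem star_mul_self_le_absPow (T : H →L[ℂ] H) {s q : ℝ} (hs : 0 < s) (hq : 2 ≤ q) :
    star T * T ≤ (s ^ 2) • (1 : H →L[ℂ] H) + (s ^ (2 - q)) • absPow T q := by
  have hP : 0 ≤ CFC.abs T := CFC.abs_nonneg T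
  have hcont : Continuous fun x : ℝ => x ^ q := Real.continuous_rpow_const (by linarith)
  have hsa : IsSelfAdjoint (CFC.abs T) := .of_nonneg hP
  have e1 : star T * T = cfc (fun x : ℝ => x * x) (CFC.abs T) := by
    rw [cfc_mul (fun x : ℝ => x) (fun x : ℝ => x) (CFC.abs T), cfc_id' ℝ (CFC.abs T),
      CFC.abs_mul_abs]
  have e2 : (s ^ 2) • (1 : H →L[ℂ] H) + (s ^ (2 - q)) • absPow T q =
      cfc (fun x : ℝ => s ^ 2 + s ^ (2 - q) * x ^ q) (CFC.abs T) := by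
    rw [cfc_const_add (s ^ 2) (fun x : ℝ => s ^ (2 - q) * x ^ q) (CFC.abs T)
      (by fun_prop), cfc_const_mul (s ^ (2 - q)) (fun x : ℝ => x ^ q) (CFC.abs T)
      hcont.continuousOn, absPow, CFC.rpow_eq_cfc_real hP, Algebra.algebraMap_eq_smul_one]
  rw [e1, e2]
  refine cfc_mono (fun x hx => mul_self_le_sq_add_rpow hs hq (spectrum_nonneg_of_nonneg hP hx))
    (by fun_prop) (by fun_prop)

theorem norm_apply_sq_le_absPow (T : H →L[ℂ] H) {s q : ℝ} (hs : 0 < s) (hq : 2 ≤ q) (v : H) :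
    ‖T v‖ ^ 2 ≤ s ^ 2 * ‖v‖ ^ 2 + s ^ (2 - q) * (inner ℂ v (absPow T q v)).re := by
  have h := (star_mul_self_le_absPow T hs hq)
  rw [ContinuousLinearMap.le_def] at h
  have h2 := h.re_inner_nonneg_right v
  have h3 : (inner ℂ v ((star T * T) v)).re = ‖T v‖ ^ 2 := by
    rw [mul_apply_eq_comp, ContinuousLinearMap.star_eq_adjoint,
      ContinuousLinearMap.adjoint_inner_right]
    exact inner_self_eq_norm_sq (𝕜 := ℂ) (T v)
  have h4 : (inner ℂ v v).re = ‖v‖ ^ 2 := inner_self_eq_norm_sq (𝕜 := ℂ) v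
  simp only [sub_apply, add_apply, inner_sub_right,
    inner_add_right, map_sub, map_add, RCLike.re_to_complex, h3, smul_apply,
    one_apply_eq_self, inner_smul_right_eq_smul, Complex.smul_re, h4,
    smul_eq_mul] at h2
  linarith

/-- A positive operator has quadratic form at most `|Y|² c` at a sum of `|Y|` vectors at which it is
at most `c`. -/
theorem re_inner_sum_le_card_sq {ι : Type*} {S : H →L[ℂ] H} (hS : 0 ≤ S) (Y : Finset ι)
    (v : ι → H) {c : ℝ} (hc : ∀ y ∈ Y, (inner ℂ (v y) (S (v y))).re ≤ c) :
    (inner ℂ (∑ y ∈ Y, v y) (S (∑ y ∈ Y, v y))).re ≤ (Y.card : ℝ) ^ 2 * c := by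
  rcases Y.eq_empty_or_nonempty with rfl | ⟨y₀, hy₀⟩
  · simp
  -- The form is `‖S^{1/2} w‖²`, so the triangle inequality applies to the square roots.
  have key : ∀ w, (inner ℂ w (S w)).re = ‖CFC.sqrt S w‖ ^ 2 := fun w => by
    have hsa : IsSelfAdjoint (CFC.sqrt S) := .of_nonneg (CFC.sqrt_nonneg S)
    conv_lhs => rw [← CFC.sqrt_mul_sqrt_self S hS, mul_apply_eq_comp,
      ← ContinuousLinearMap.adjoint_inner_left, ← ContinuousLinearMap.star_eq_adjoint, hsa.star_eq]
    exact inner_self_eq_norm_sq (𝕜 := ℂ) _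
  have hc0 : 0 ≤ c := by
    have := hc y₀ hy₀
    rw [key] at this
    exact (sq_nonneg _).trans this
  have h1 : ‖CFC.sqrt S (∑ y ∈ Y, v y)‖ ≤ Y.card * Real.sqrt c := by
    rw [map_sum]
    refine (norm_sum_le_of_le Y fun y hy => Real.le_sqrt_of_sq_le ?_).trans
      (by rw [Finset.sum_const, nsmul_eq_mul])
    rw [← key]
    exact hc y hy
  rw [key, ← Real.sq_sqrt hc0, ← mul_pow]
  gcongr

end OperatorInequality

section PointMasses

variable {G : Type*}

/-- The point mass at `x`, as a vector of `ℓ²(G)`. -/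
def delta (x : G) : L2 G :=
  open Classical in lp.single 2 x (1 : ℂ)

open Classical in
theorem delta_apply (x s : G) : (delta x : L2 G) s = if s = x then 1 else 0 := by
  simp [delta, Pi.single_apply]

theorem inner_delta [DecidableEq G] (x y : G) :
    inner ℂ (delta x) (delta y) = if x = y then (1 : ℂ) else 0 := by
  have h : inner ℂ (delta x) (delta y) = inner ℂ (1 : ℂ) ((delta y : L2 G) x) := by
    exact @lp.inner_single_left G ℂ _ (fun _ => ℂ) _ _ (Classical.decEq G) x 1 (delta y)
  rw [h, delta_apply]
  by_cases hxy : x = y <;> simp [hxy]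

/-- The indicator function of a finite set, as a vector of `ℓ²(G)`. -/
def finsetVec (Y : Finset G) : L2 G := ∑ y ∈ Y, delta y

theorem inner_finsetVec [DecidableEq G] (Y Z : Finset G) :
    inner ℂ (finsetVec Y) (finsetVec Z) = (((Y.filter (· ∈ Z)).card : ℝ) : ℂ) := by
  simp [finsetVec, inner_delta, Finset.filter_mem_eq_inter, Finset.inter_comm]

theorem norm_finsetVec_sq (Y : Finset G) : ‖finsetVec Y‖ ^ 2 = Y.card := by
  classical
  have h := inner_self_eq_norm_sq (𝕜 := ℂ) (finsetVec Y)
  rw [← h, inner_finsetVec]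
  simp

theorem finsetVec_apply_of_notMem {Y : Finset G} {x : G} (hx : x ∉ Y) : finsetVec Y x = 0 := by
  classical
  rw [finsetVec, lp.coeFn_sum, Finset.sum_apply]
  refine Finset.sum_eq_zero fun y hy => ?_
  rw [delta_apply, if_neg (by rintro rfl; exact hx hy)]

end PointMasses

/-! ### Translations and the group von Neumann algebra. -/

variable {G : Type*} [Group G]

theorem deltaOne_eq_delta : deltaOne G = delta 1 := rfl

/-- Right translation by `u`, `g ↦ (s ↦ g (s u⁻¹))`, as a linear isometry of `ℓ²(G)`. -/
def rightTranslate (u : G) : L2 G →ₗᵢ[ℂ] L2 G where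
  toFun g := ⟨fun s => g (s * u⁻¹), by
    have h := (memℓp_gen_iff (p := 2) (by norm_num)).1 (lp.memℓp g)
    exact (memℓp_gen_iff (p := 2) (by norm_num)).2
      ((Equiv.mulRight u⁻¹).summable_iff.2 h)⟩
  map_add' _ _ := rfl
  map_smul' _ _ := rfl
  norm_map' g := by
    rw [lp.norm_eq_tsum_rpow (by norm_num), lp.norm_eq_tsum_rpow (by norm_num)]
    congr 1
    exact (Equiv.mulRight u⁻¹).tsum_eq (fun s => ‖g s‖ ^ (2 : ℝ≥0∞).toReal)

/-- Right translation as a bounded operator. -/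
abbrev rightOp (u : G) : L2 G →L[ℂ] L2 G := (rightTranslate u).toContinuousLinearMap

theorem rightOp_apply (u : G) (g : L2 G) (s : G) : rightOp u g s = g (s * u⁻¹) := rfl

theorem rightOp_delta (u x : G) : rightOp u (delta x) = delta (x * u) := by
  classical
  ext s
  rw [rightOp_apply, delta_apply, delta_apply, mul_inv_eq_iff_eq_mul]

theorem leftRegular_apply (t : G) (g : L2 G) (s : G) : leftRegular G t g s = g (t⁻¹ * s) := rfl

theorem leftRegular_delta (t x : G) : leftRegular G t (delta x) = delta (t * x) := by
  classical
  ext s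
  rw [leftRegular_apply, delta_apply, delta_apply, inv_mul_eq_iff_eq_mul]

theorem star_leftRegular (t : G) : star (leftRegular G t) = leftRegular G t⁻¹ := by
  have h1 : star (leftRegular G t) * leftRegular G t = 1 :=
    (ContinuousLinearMap.norm_map_iff_adjoint_comp_self _).1 (translate t).norm_map
  have h2 : leftRegular G t * leftRegular G t⁻¹ = 1 := by rw [← map_mul]; simp
  exact left_inv_eq_right_inv h1 h2

theorem leftRegular_mul_rightOp (t u : G) :
    leftRegular G t * rightOp u = rightOp u * leftRegular G t := by
  ext g s
  change g (t⁻¹ * s * u⁻¹) = g (t⁻¹ * (s * u⁻¹))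
  rw [mul_assoc]

theorem leftRegular_mem_groupVN (t : G) : leftRegular G t ∈ groupVN G := by
  change leftRegular G t ∈ StarSubalgebra.centralizer ℂ _
  rw [StarSubalgebra.mem_centralizer_iff]
  intro R hR
  have hR' := hR
  rw [SetLike.mem_coe, StarSubalgebra.mem_centralizer_iff] at hR
  have hR2 := (StarSubalgebra.mem_centralizer_iff ℂ).1 (star_mem hR')
  exact ⟨(hR _ ⟨t, rfl⟩).1.symm, (hR2 _ ⟨t, rfl⟩).1.symm⟩

/-- Right translations lie in the commutant of `λ(G)`; only this easy half of the commutation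
theorem is needed. -/
theorem commute_rightOp_of_mem_groupVN {T : L2 G →L[ℂ] L2 G} (hT : T ∈ groupVN G) (u : G) :
    Commute T (rightOp u) := by
  change T ∈ StarSubalgebra.centralizer ℂ _ at hT
  rw [StarSubalgebra.mem_centralizer_iff] at hT
  refine ((hT (rightOp u) ?_).1).symm
  rw [SetLike.mem_coe, StarSubalgebra.mem_centralizer_iff]
  rintro _ ⟨t, rfl⟩
  rw [star_leftRegular]
  exact ⟨leftRegular_mul_rightOp t u, leftRegular_mul_rightOp t⁻¹ u⟩

theorem apply_delta_of_commute {T : L2 G →L[ℂ] L2 G} (hT : ∀ u, Commute T (rightOp u)) (x : G) :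
    T (delta x) = rightOp x (T (deltaOne G)) := by
  have := congrArg (fun R : L2 G →L[ℂ] L2 G => R (delta 1)) (hT x).eq
  rwa [mul_apply_eq_comp, mul_apply_eq_comp, rightOp_delta, one_mul] at this

theorem convOp_mem_groupVN (f : G →₀ ℂ) : convOp f ∈ groupVN G :=
  sum_mem fun t _ => (groupVN G).toStarSubalgebra.smul_mem (leftRegular_mem_groupVN t) _

theorem commute_absPow_rightOp {T : L2 G →L[ℂ] L2 G} (hT : T ∈ groupVN G) {q : ℝ} (u : G) :
    Commute (absPow T q) (rightOp u) := by
  have h : Commute (star T * T) (rightOp u) :=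
    commute_rightOp_of_mem_groupVN (mul_mem (star_mem hT) hT) u
  exact commute_absPow h q

/-- `|T|^q` commutes with the isometric right translations, which carry `δ_e` to every point mass.
-/
theorem inner_delta_absPow {T : L2 G →L[ℂ] L2 G} (hT : T ∈ groupVN G) (q : ℝ) (x : G) :
    inner ℂ (delta x) (absPow T q (delta x)) = trace (absPow T q) := by
  rw [apply_delta_of_commute (commute_absPow_rightOp hT)]
  have : delta x = rightOp x (deltaOne G) := by rw [deltaOne_eq_delta, rightOp_delta, one_mul]
  rw [this]
  exact (rightTranslate x).inner_map_map _ _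

/-! ### Counting products. -/

/-- Counting lemma: if `T` is convolution by the indicator of `F`, the number of pairs
`(x, y) ∈ F × Y` with `xy ∈ Z` is at most `‖T 1_Y‖ |Z|^{1/2}`. -/
theorem card_mul_mem_le_norm [DecidableEq G] {T : L2 G →L[ℂ] L2 G}
    (hT : ∀ u, Commute T (rightOp u)) {F : Finset G} (hF : T (deltaOne G) = finsetVec F)
    (Y Z : Finset G) :
    (((F ×ˢ Y).filter fun p => p.1 * p.2 ∈ Z).card : ℝ) ≤
      ‖finsetVec Z‖ * ‖T (finsetVec Y)‖ := by
  have h : inner ℂ (finsetVec Z) (T (finsetVec Y)) =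
      ((((F ×ˢ Y).filter fun p => p.1 * p.2 ∈ Z).card : ℝ) : ℂ) := by
    have hTY : T (finsetVec Y) = ∑ y ∈ Y, ∑ x ∈ F, delta (x * y) := by
      rw [finsetVec, map_sum]
      refine Finset.sum_congr rfl fun y _ => ?_
      rw [apply_delta_of_commute hT, hF, finsetVec, map_sum]
      exact Finset.sum_congr rfl fun x _ => rightOp_delta y x
    rw [hTY, Finset.card_filter, Finset.sum_product_right, inner_sum]
    push_cast
    refine Finset.sum_congr rfl fun y _ => ?_
    rw [inner_sum]
    refine Finset.sum_congr rfl fun x _ => ?_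
    rw [finsetVec, sum_inner]
    simp_rw [inner_delta, Finset.sum_ite_eq']
    split_ifs <;> simp
  have h2 := norm_inner_le_norm (𝕜 := ℂ) (finsetVec Z) (T (finsetVec Y))
  rwa [h, Complex.norm_real, Real.norm_of_nonneg (by positivity)] at h2

theorem card_le_of_lambdaBounds {E : Set G} {q C : ℝ} (hq : 2 < q) (hC : C ∈ lambdaBounds q E)
    {a : G} {n : ℕ} (hn : 0 < n) (ha : orderOf a = 0 ∨ n ≤ orderOf a) {F : Finset G}
    (hFE : (F : Set G) ⊆ E) (hF : ∀ x ∈ F, ∃ j : ℕ, 1 ≤ j ∧ j ≤ n ∧ x = a ^ j) :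
    (F.card : ℝ) ≤ 4 * C ^ 2 * (n : ℝ) ^ (2 / q) := by
  classical
  obtain ⟨hC0, hC⟩ := hC
  set f : G →₀ ℂ := Finsupp.indicator F fun _ _ => 1 with hf
  have hfF : f.support = F := by ext x; simp [hf, Finsupp.indicator_apply]
  have hf1 : ∀ x ∈ F, f x = 1 := fun x hx => by simp [hf, Finsupp.indicator_apply, hx]
  set T := convOp f with hTdef
  have hTm : T ∈ groupVN G := convOp_mem_groupVN f
  have hTF : T (deltaOne G) = finsetVec F := by
    rw [hTdef, convOp, Finsupp.sum, hfF, finsetVec, sum_apply]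
    refine Finset.sum_congr rfl fun x hx => ?_
    rw [hf1 x hx, one_smul, deltaOne_eq_delta, leftRegular_delta, mul_one]
  set N := ncLpNorm q T with hN
  have hNle : N ≤ C * Real.sqrt F.card := by
    have := hC f (by rw [hfF]; exact hFE)
    rw [hfF, Finset.sum_congr rfl fun x hx => by rw [hf1 x hx]] at this
    simpa using this
  set τ := (trace (absPow T q)).re with hτ
  have hτ0 : 0 ≤ τ := by
    have h := absPow_nonneg T q
    rw [ContinuousLinearMap.nonneg_iff_isPositive] at h
    exact h.re_inner_nonneg_right (deltaOne G)
  have hNτ : N = τ ^ (1 / q) := rfl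
  have hN0 : 0 ≤ N := by rw [hNτ]; positivity
  have hτN : τ = N ^ q := by
    rw [hNτ, ← Real.rpow_mul hτ0, one_div_mul_cancel (by linarith), Real.rpow_one]
  set Y : Finset G := (Finset.Icc 1 n).image fun j => a ^ j with hY
  set Z : Finset G := (Finset.Icc 1 (2 * n)).image fun j => a ^ j with hZ
  have hYc : Y.card = n := by
    rw [hY, Finset.card_image_of_injOn]
    · simp
    intro i hi j hj hij
    simp only [Finset.coe_Icc, Set.mem_Icc] at hi hj
    rw [pow_eq_pow_iff_modEq] at hij
    -- `orderOf a = 0` encodes infinite order, and congruence modulo 0 is equality.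
    rcases ha with h0 | h0
    · rw [h0] at hij
      simpa using Nat.modEq_zero_iff.1 hij
    · have hd := (Nat.modEq_iff_dvd.1 hij)
      have := Int.eq_zero_of_abs_lt_dvd hd (by rw [abs_lt]; omega)
      omega
  -- Powers in `Z` may coincide; only an upper bound on its size is used, so order at least `n`
  -- suffices.
  have hZc : Z.card ≤ 2 * n := Finset.card_image_le.trans (by simp)
  have hcount : ((F ×ˢ Y).filter fun p => p.1 * p.2 ∈ Z) = F ×ˢ Y := by
    refine Finset.filter_true_of_mem fun p hp => ?_
    obtain ⟨h1, h2⟩ := Finset.mem_product.1 hp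
    obtain ⟨i, hi1, hi2, hi⟩ := hF _ h1
    obtain ⟨j, hj, hj'⟩ := Finset.mem_image.1 h2
    rw [Finset.mem_Icc] at hj
    refine Finset.mem_image.2 ⟨i + j, Finset.mem_Icc.2 (by omega), ?_⟩
    rw [hi, ← hj', pow_add]
  have hn0 : (0 : ℝ) < n := by exact_mod_cast hn
  have hlow : (F.card : ℝ) ^ 2 * n ≤ 2 * ‖T (finsetVec Y)‖ ^ 2 := by
    have h := card_mul_mem_le_norm (commute_rightOp_of_mem_groupVN hTm) hTF Y Z
    rw [hcount, Finset.card_product, hYc] at h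
    push_cast at h
    have h2 := pow_le_pow_left₀ (mul_nonneg (Nat.cast_nonneg _) (Nat.cast_nonneg _)) h 2
    rw [mul_pow, mul_pow, norm_finsetVec_sq] at h2
    have h3 : (Z.card : ℝ) ≤ 2 * n := by exact_mod_cast hZc
    have h4 : (F.card : ℝ) ^ 2 * n ^ 2 ≤ 2 * n * ‖T (finsetVec Y)‖ ^ 2 :=
      h2.trans (by gcongr)
    refine le_of_mul_le_mul_right ?_ hn0
    linarith
  have hquad : (inner ℂ (finsetVec Y) (absPow T q (finsetVec Y))).re ≤ (n : ℝ) ^ 2 * τ := by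
    have := re_inner_sum_le_card_sq (absPow_nonneg T q) Y delta (c := τ)
      fun y _ => by rw [inner_delta_absPow hTm q y]
    rwa [hYc] at this
  -- The value of `s` at which `s²n` and `s^{2-q} n² τ` balance.
  set M := (n : ℝ) ^ (1 / q) * N with hM
  have hM0 : 0 ≤ M := by positivity
  have hMq : M ^ q = n * τ := by
    rw [hM, Real.mul_rpow (by positivity) hN0, ← Real.rpow_mul hn0.le,
      one_div_mul_cancel (by linarith), Real.rpow_one, hτN]
  -- `M` could be 0 while the operator inequality needs `s > 0`; hence `s > M`, then a limit.
  have hs : ∀ s, M < s → (F.card : ℝ) ^ 2 ≤ 4 * s ^ 2 := by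
    intro s hMs
    have hs0 : 0 < s := hM0.trans_lt hMs
    have h1 := norm_apply_sq_le_absPow T hs0 hq.le (finsetVec Y)
    rw [norm_finsetVec_sq, hYc] at h1
    have h2 : s ^ (2 - q) * (inner ℂ (finsetVec Y) (absPow T q (finsetVec Y))).re ≤
        s ^ 2 * n := by
      calc _ ≤ s ^ (2 - q) * ((n : ℝ) ^ 2 * τ) := by gcongr
        _ = s ^ (2 - q) * M ^ q * n := by rw [hMq]; ring
        _ ≤ s ^ (2 - q) * s ^ q * n := by gcongr
        _ = s ^ 2 * n := by rw [← Real.rpow_add hs0, sub_add_cancel, Real.rpow_two]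
    refine le_of_mul_le_mul_right ?_ hn0
    linarith
  have hFM : (F.card : ℝ) ^ 2 ≤ 4 * M ^ 2 := by
    have hcont : Continuous fun s : ℝ => 4 * s ^ 2 := by fun_prop
    exact ge_of_tendsto (hcont.continuousWithinAt (s := Set.Ioi M) (x := M))
      (Filter.eventually_of_mem self_mem_nhdsWithin hs)
  have hn2 : ((n : ℝ) ^ (1 / q)) ^ 2 = (n : ℝ) ^ (2 / q) := by
    rw [← Real.rpow_natCast, ← Real.rpow_mul hn0.le]
    congr 1
    push_cast
    ring
  have hN2 : N ^ 2 ≤ C ^ 2 * F.card := by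
    have := pow_le_pow_left₀ hN0 hNle 2
    rwa [mul_pow, Real.sq_sqrt (Nat.cast_nonneg _)] at this
  rcases Nat.eq_zero_or_pos F.card with h0 | h0
  · rw [h0]; push_cast; positivity
  · have hc : (0 : ℝ) < F.card := by exact_mod_cast h0
    refine le_of_mul_le_mul_right ?_ hc
    calc (F.card : ℝ) * F.card = (F.card : ℝ) ^ 2 := (sq _).symm
      _ ≤ 4 * ((n : ℝ) ^ (2 / q) * N ^ 2) := by rw [← hn2, ← mul_pow]; exact hFM
      _ ≤ 4 * ((n : ℝ) ^ (2 / q) * (C ^ 2 * F.card)) := by gcongr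
      _ = _ := by ring

/-- If `F` is quasi-independent, convolution by its indicator has norm at least `|F| / 2`. -/
theorem card_le_two_mul_norm_of_quasiIndependent {F : Finset G} (hF : (F : Set G).Pairwise Commute)
    (hQ : QuasiIndependent (F : Set G) hF) {T : L2 G →L[ℂ] L2 G} (hT : T ∈ groupVN G)
    (hTF : T (deltaOne G) = finsetVec F) : (F.card : ℝ) ≤ 2 * ‖T‖ := by
  classical
  let p : Finset G → G := fun S =>
    if h : S ⊆ F then S.noncommProd id (hF.mono (Finset.coe_subset.2 h)) else 1
  have hp : ∀ S (h : S ⊆ F), p S = S.noncommProd id (hF.mono (Finset.coe_subset.2 h)) :=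
    fun S h => dif_pos h
  have hinj : Set.InjOn p (F.powerset : Set (Finset G)) := by
    intro S hS S' hS' h
    rw [Finset.mem_coe, Finset.mem_powerset] at hS hS'
    rw [hp S hS, hp S' hS'] at h
    exact hQ S S' (Finset.coe_subset.2 hS) (Finset.coe_subset.2 hS') h
  set Y := F.powerset.image p with hY
  have hYc : Y.card = 2 ^ F.card := by
    rw [hY, Finset.card_image_of_injOn hinj, Finset.card_powerset]
  -- If `x ∉ S`, multiplying the product over `S` by `x` gives the product over `insert x S`. There
  -- are `|F| 2^{|F|-1}` such pairs `(x, S)`.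
  have hcount : 2 ^ F.card * F.card ≤
      2 * ((F ×ˢ Y).filter fun r => r.1 * r.2 ∈ Y).card := by
    have h1 : (F.sigma fun x => (F.erase x).powerset).card ≤
        ((F ×ˢ Y).filter fun r => r.1 * r.2 ∈ Y).card := by
      refine Finset.card_le_card_of_injOn (fun r => (r.1, p r.2)) ?_ ?_
      · rintro ⟨x, S⟩ hr
        simp only [Finset.coe_sigma, Set.mem_sigma_iff, Finset.mem_coe, Finset.mem_powerset] at hr
        obtain ⟨hx, hS⟩ := hr
        have hSF : S ⊆ F := hS.trans (Finset.erase_subset x F)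
        have hxS : x ∉ S := fun h => Finset.notMem_erase x F (hS h)
        have hins : insert x S ⊆ F := Finset.insert_subset hx hSF
        simp only [Finset.coe_filter, Finset.mem_product, Set.mem_ofPred_eq]
        refine ⟨⟨hx, Finset.mem_image_of_mem p (Finset.mem_powerset.2 hSF)⟩, ?_⟩
        have : x * p S = p (insert x S) := by
          rw [hp _ hins, hp _ hSF, Finset.noncommProd_insert_of_notMem _ _ _ _ hxS, id]
        rw [this]
        exact Finset.mem_image_of_mem p (Finset.mem_powerset.2 hins)
      · rintro ⟨x, S⟩ hr ⟨x', S'⟩ hr' h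
        simp only [Finset.coe_sigma, Set.mem_sigma_iff, Finset.mem_coe, Finset.mem_powerset]
          at hr hr'
        simp only [Prod.mk.injEq] at h
        obtain ⟨rfl, h⟩ := h
        have := hinj (Finset.mem_coe.2 (Finset.mem_powerset.2 (hr.2.trans (Finset.erase_subset _ F))))
          (Finset.mem_coe.2 (Finset.mem_powerset.2 (hr'.2.trans (Finset.erase_subset _ F)))) h
        rw [this]
    rw [Finset.card_sigma, Finset.sum_congr rfl fun x hx => by
      rw [Finset.card_powerset, Finset.card_erase_of_mem hx], Finset.sum_const, smul_eq_mul] at h1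
    rcases Nat.eq_zero_or_pos F.card with h0 | h0
    · simp [h0]
    · obtain ⟨k, hk⟩ := Nat.exists_eq_succ_of_ne_zero h0.ne'
      rw [hk, Nat.succ_sub_one] at h1
      rw [hk, pow_succ]
      linarith
  have hkey := card_mul_mem_le_norm (commute_rightOp_of_mem_groupVN hT) hTF Y Y
  have h2 : ‖finsetVec Y‖ * ‖T (finsetVec Y)‖ ≤ 2 ^ F.card * ‖T‖ := by
    calc _ ≤ ‖finsetVec Y‖ * (‖T‖ * ‖finsetVec Y‖) := by gcongr; exact T.le_opNorm _
      _ = ‖finsetVec Y‖ ^ 2 * ‖T‖ := by ring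
      _ = _ := by rw [norm_finsetVec_sq, hYc]; push_cast; ring
  have hcount' : (2 : ℝ) ^ F.card * F.card ≤
      2 * (((F ×ˢ Y).filter fun r => r.1 * r.2 ∈ Y).card : ℝ) := by exact_mod_cast hcount
  refine le_of_mul_le_mul_left ?_ (by positivity : (0 : ℝ) < 2 ^ F.card)
  linarith

theorem card_le_of_leinertBounds {E : Set G} {C : ℝ} (hC : C ∈ leinertBounds E) {F : Finset G}
    (hF : (F : Set G).Pairwise Commute) (hFE : (F : Set G) ⊆ E)
    (hQ : QuasiIndependent (F : Set G) hF) : (F.card : ℝ) ≤ 4 * C ^ 2 := by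
  obtain ⟨hC0, hC⟩ := hC
  have h1 := hC (finsetVec F) fun x hx => finsetVec_apply_of_notMem fun h => hx (hFE h)
  have h2 : ENNReal.ofReal (F.card / 2) ≤ vnNorm (finsetVec F) := by
    -- Every admissible `T` obeys the lower bound, so uniqueness of `T` plays no role.
    refine le_iInf fun T => le_iInf fun hT => le_iInf fun hTF => ?_
    rw [← ofReal_norm]
    refine ENNReal.ofReal_le_ofReal ?_
    linarith [card_le_two_mul_norm_of_quasiIndependent hF hQ hT hTF]
  have h3 := h2.trans h1
  rw [← ofReal_norm, ← ENNReal.ofReal_mul hC0.le,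
    ENNReal.ofReal_le_ofReal_iff (by positivity)] at h3
  have h4 := pow_le_pow_left₀ (by positivity) h3 2
  rw [mul_pow, norm_finsetVec_sq] at h4
  rcases Nat.eq_zero_or_pos F.card with h0 | h0
  · rw [h0]; push_cast; positivity
  · have hc : (0 : ℝ) < F.card := by exact_mod_cast h0
    refine le_of_mul_le_mul_right ?_ hc
    nlinarith

/-! ### Passage to the optimal constants. -/

/-- An upper bound by `c C²` for every `C` in a nonempty set of positive reals persists at its
infimum. -/
theorem le_mul_sInf_sq {S : Set ℝ} (hS : S.Nonempty) (hpos : ∀ C ∈ S, 0 < C) {m c : ℝ}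
    (h : ∀ C ∈ S, m ≤ c * C ^ 2) : m ≤ c * sInf S ^ 2 := by
  have hbdd : BddBelow S := ⟨0, fun C hC => (hpos C hC).le⟩
  have hcl := csInf_mem_closure hS hbdd
  have hclosed : IsClosed {C : ℝ | m ≤ c * C ^ 2} :=
    isClosed_le continuous_const (by fun_prop)
  exact closure_minimal h hclosed hcl

end DiscreteGroup

end

theorem mainTheorem2 {G : Type*} [Group G] (E : Set G) :
    (∀ q : ℝ, 2 < q → DiscreteGroup.IsLambdaSet q E →
      ∀ (a : G) (n : ℕ), (orderOf a = 0 ∨ 2 * n ≤ orderOf a) →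
        ((E ∩ {x : G | ∃ j : ℕ, 1 ≤ j ∧ j ≤ n ∧ x = a ^ j}).ncard : ℝ)
          ≤ 10 * DiscreteGroup.lambdaConst q E ^ 2 * (n : ℝ) ^ (2 / q)) ∧
    (DiscreteGroup.IsLeinert E →
      ∀ (F : Finset G) (hF : (F : Set G).Pairwise Commute), (F : Set G) ⊆ E →
        DiscreteGroup.QuasiIndependent (F : Set G) hF →
        (F.card : ℝ) ≤ 6 ^ 3 * DiscreteGroup.leinertConst E ^ 2) := by
  constructor
  · intro q hq hE a n ha
    have hfin : (E ∩ {x : G | ∃ j : ℕ, 1 ≤ j ∧ j ≤ n ∧ x = a ^ j}).Finite := by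
      refine ((Set.finite_Icc 1 n).image fun j => a ^ j).subset ?_
      rintro x ⟨-, j, h1, h2, rfl⟩
      exact ⟨j, ⟨h1, h2⟩, rfl⟩
    rw [Set.ncard_eq_toFinset_card _ hfin]
    rcases Nat.eq_zero_or_pos n with rfl | hn
    · have : hfin.toFinset = ∅ := by
        ext x
        simp only [Set.Finite.mem_toFinset, Finset.notMem_empty, iff_false]
        rintro ⟨-, j, h1, h2, -⟩
        omega
      rw [this, Finset.card_empty]
      push_cast
      positivity
    · have hb : ∀ C ∈ DiscreteGroup.lambdaBounds q E,
          (hfin.toFinset.card : ℝ) ≤ 4 * (n : ℝ) ^ (2 / q) * C ^ 2 := fun C hC => by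
        have := DiscreteGroup.card_le_of_lambdaBounds hq hC hn
          (ha.imp_right fun h => by omega : orderOf a = 0 ∨ n ≤ orderOf a) (F := hfin.toFinset)
          (by simp) (fun x hx => (hfin.mem_toFinset.1 hx).2)
        linarith
      have h := DiscreteGroup.le_mul_sInf_sq hE (fun C hC => hC.1) hb
      have h0 : 0 ≤ DiscreteGroup.lambdaConst q E ^ 2 * (n : ℝ) ^ (2 / q) := by positivity
      rw [← DiscreteGroup.lambdaConst] at h
      linarith
  · intro hE F hF hFE hQ
    have h := DiscreteGroup.le_mul_sInf_sq hE (fun C hC => hC.1)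
      fun C hC => DiscreteGroup.card_le_of_leinertBounds hC hF hFE hQ
    rw [← DiscreteGroup.leinertConst] at h
    linarith [sq_nonneg (DiscreteGroup.leinertConst E)]
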